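/- Let $G=(V,E)$ be a locally finite connected simple graph (finite or infinite), and let each edge $e\in E$ be open with probability $p_e\in[0,1]$ and closed otherwise, independently of all other edges (Bernoulli bond percolation; the $p_e$ may differ from edge to edge). Write $\mathbb P$ for the corresponding product measure on $\{0,1\}^E$; clusters are the connected components of the graph formed by the vertices of $G$ and its open edges. For vertices $u,v,w$, let $uv$ be the event that $u$ and $v$ lie in the same cluster, and $uvw$ the event that $u$, $v$ and $w$ all lie in the same cluster. Then for all distinct vertices $a,b,c\in V$, $$\mathbb P(abc)^2\le 8\,\mathbb P(ab)\,\mathbb P(ac)\,\mathbb P(bc)$$ and $$\mathbb P(abc)^2\le 2\,\mathbb P(ab\cup ac)^2\,\mathbb P(bc).$$ Consequently, whenever $\mathbb P(ab)\,\mathbb P(ac)\,\mathbb P(bc)>0$, $$\frac{\mathbb P(abc)}{\sqrt{\mathbb P(ab)\,\mathbb P(ac)\,\mathbb P(bc)}}\le\sqrt 8 .$$ -/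

import Mathlib

namespace BondPercolation

variable {V : Type*} (G : SimpleGraph V)

/-- A percolation configuration on `G`: each edge is open (`true`) or closed (`false`). -/
abbrev Config : Type _ := G.edgeSet → Bool

/-- The Bernoulli bond percolation measure: the product measure under which the edges are
independent and each edge `e` is open with its own probability `p e`. -/
noncomputable def percMeasure (p : G.edgeSet → unitInterval) :
    MeasureTheory.Measure (Config G) :=
  MeasureTheory.Measure.infinitePi
    (fun e => ProbabilityTheory.bernoulliMeasure true false (p e))

/-- The spanning subgraph of `G` formed by the open edges of `ω`. Its connected components are
the percolation clusters. -/
def openGraph (ω : Config G) : SimpleGraph V where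
  Adj u v := ∃ h : G.Adj u v, ω ⟨s(u, v), h⟩ = true
  symm := ⟨fun u v ⟨h, hω⟩ => ⟨h.symm, by simpa only [Sym2.eq_swap] using hω⟩⟩
  loopless := ⟨fun _ ⟨h, _⟩ => h.ne rfl⟩

/-- The event that all the vertices in `s` belong to the same percolation cluster. -/
def sameCluster (s : Set V) : Set (Config G) :=
  {ω | ∀ u ∈ s, ∀ v ∈ s, (openGraph G ω).Reachable u v}

/-- The probability of an event of Bernoulli bond percolation. -/
noncomputable def prob (p : G.edgeSet → unitInterval) (A : Set (Config G)) : ℝ :=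
  (percMeasure G p).real A

end BondPercolation

open BondPercolation

open BondPercolation
namespace BondPercolation

/-! In finite volume, explore the cluster of `a` depth-first until `b` or `c` is visited or nothing
is left. Suppose `b` comes first. The stack is then an open path from `a` to `b`, and every edge
leaving a visited vertex off the stack is known to be closed. Given this, `abc` forces `c` to reach
some stack vertex through unexplored edges. Take two independent copies of these edges, in which `c`
reaches `x` and `y` respectively. According to the order of `x` and `y` on the path, one copy yields
`ac` and the other `bc`, using disjoint pieces of the path. The squared conditional probability is
thus at most `2 * splitProb` (`Found.sq_condProb_le`).

By a van den Berg–Kesten argument (`splitProb_split`), the mean of `splitProb` over the final states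
is at most its initial value, a product of two probabilities. Cauchy–Schwarz (`sq_convex_comb_le`)
against the conditional probability of `ab`, which is 1 when `b` has been found, bounds the squared
contribution of these runs by `2 P(ab) P(ac) P(bc)`. The runs that find `c` are symmetric, and
adding the two contributions gives 8. For the second bound, `ab ∪ ac` treats both kinds of run in
one Cauchy–Schwarz.

Both averages are taken one query at a time, by induction on `Explorable`. Infinite graphs follow by
monotone limits. -/

/-- The real-valued indicator of a proposition. -/
noncomputable def ind (P : Prop) : ℝ := by
  classical exact if P then 1 else 0

lemma ind_of_true {P : Prop} (h : P) : ind P = 1 := by simp [ind, h]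

lemma ind_of_false {P : Prop} (h : ¬ P) : ind P = 0 := by simp [ind, h]

lemma ind_nonneg (P : Prop) : 0 ≤ ind P := by
  by_cases h : P <;> simp [ind, h]

lemma ind_mono {P Q : Prop} (h : P → Q) : ind P ≤ ind Q := by
  by_cases hP : P
  · simp [ind, hP, h hP]
  · simpa [ind, hP] using ind_nonneg Q

/-! ### Finite product measures, and sharing explored edges between two copies. -/

section Expectation

variable {E : Type*} [DecidableEq E] (F : Finset E) (p : E → ℝ)

/-- The probability that `T` is the set of open elements of `F`. -/
noncomputable def weight (T : Finset E) : ℝ :=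
  (∏ e ∈ T, p e) * ∏ e ∈ F \ T, (1 - p e)

/-- The expectation of `f` over the random set of open elements of the finite set `F`. -/
noncomputable def expect (f : Finset E → ℝ) : ℝ :=
  ∑ T ∈ F.powerset, weight F p T * f T

/-- The probability that the random set of open elements of `F` satisfies `A`. -/
noncomputable def finProb (A : Finset E → Prop) : ℝ :=
  expect F p fun T => ind (A T)

variable {F p}

lemma weight_nonneg (hp : ∀ e, p e ∈ Set.Icc (0 : ℝ) 1) (T : Finset E) : 0 ≤ weight F p T :=
  mul_nonneg (Finset.prod_nonneg fun e _ => (hp e).1)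
    (Finset.prod_nonneg fun e _ => sub_nonneg.2 (hp e).2)

lemma expect_mono (hp : ∀ e, p e ∈ Set.Icc (0 : ℝ) 1) {f g : Finset E → ℝ}
    (h : ∀ T ⊆ F, f T ≤ g T) : expect F p f ≤ expect F p g :=
  Finset.sum_le_sum fun T hT =>
    mul_le_mul_of_nonneg_left (h T (Finset.mem_powerset.1 hT)) (weight_nonneg hp T)

lemma expect_add (f g : Finset E → ℝ) :
    expect F p (fun T => f T + g T) = expect F p f + expect F p g := by
  simp [expect, mul_add, Finset.sum_add_distrib]

lemma expect_const_mul (c : ℝ) (f : Finset E → ℝ) :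
    expect F p (fun T => c * f T) = c * expect F p f := by
  simp only [expect, Finset.mul_sum]
  exact Finset.sum_congr rfl fun T _ => by ring

lemma expect_mul_const (c : ℝ) (f : Finset E → ℝ) :
    expect F p (fun T => f T * c) = expect F p f * c := by
  simp only [mul_comm _ c, expect_const_mul]

lemma expect_nonneg (hp : ∀ e, p e ∈ Set.Icc (0 : ℝ) 1) {f : Finset E → ℝ}
    (h : ∀ T, 0 ≤ f T) : 0 ≤ expect F p f :=
  Finset.sum_nonneg fun T _ => mul_nonneg (weight_nonneg hp T) (h T)

lemma expect_one : expect F p (fun _ => 1) = 1 := by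
  have := Finset.prod_add p (fun e => 1 - p e) F
  simpa [expect, weight] using this.symm

lemma expect_comm (f : Finset E → Finset E → ℝ) :
    expect F p (fun S => expect F p (fun T => f S T)) =
      expect F p (fun T => expect F p (fun S => f S T)) := by
  simp only [expect, Finset.mul_sum]
  rw [Finset.sum_comm]
  exact Finset.sum_congr rfl fun _ _ => Finset.sum_congr rfl fun _ _ => by ring

lemma expect_insert {e : E} (he : e ∉ F) (f : Finset E → ℝ) :
    expect (insert e F) p f =
      ∑ T ∈ F.powerset, weight F p T * (p e * f (insert e T) + (1 - p e) * f T) := by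
  rw [expect, Finset.sum_powerset_insert he, ← Finset.sum_add_distrib]
  refine Finset.sum_congr rfl fun T hT => ?_
  have heT : e ∉ T := fun h => he (Finset.mem_powerset.1 hT h)
  have h1 : insert e F \ T = insert e (F \ T) := Finset.insert_sdiff_of_notMem _ heT
  have h2 : insert e F \ insert e T = F \ T := by
    ext x; simp only [Finset.mem_sdiff, Finset.mem_insert]; grind
  have he' : e ∉ F \ T := fun h => he (Finset.mem_sdiff.1 h).1
  rw [weight, weight, weight, h1, h2, Finset.prod_insert heT, Finset.prod_insert he']
  ring

/-- Conditioning on the state of one element. -/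
lemma expect_split {e : E} (he : e ∈ F) (f : Finset E → ℝ) :
    expect F p f = p e * expect F p (fun T => f (insert e T)) +
      (1 - p e) * expect F p (fun T => f (T.erase e)) := by
  obtain ⟨F', he', rfl⟩ : ∃ F', e ∉ F' ∧ insert e F' = F :=
    ⟨F.erase e, Finset.notMem_erase e F, Finset.insert_erase he⟩
  rw [expect_insert he', expect_insert he', expect_insert he', Finset.mul_sum, Finset.mul_sum,
    ← Finset.sum_add_distrib]
  refine Finset.sum_congr rfl fun T hT => ?_
  have heT : e ∉ T := fun h => he' (Finset.mem_powerset.1 hT h)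
  rw [Finset.insert_idem, Finset.erase_insert heT, Finset.erase_eq_of_notMem heT]
  ring

variable (F p) in
/-- The expectation of `f` over two independent copies of the random set. -/
noncomputable def expect₂ (f : Finset E → Finset E → ℝ) : ℝ :=
  expect F p fun S => expect F p fun T => f S T

lemma expect₂_mono (hp : ∀ e, p e ∈ Set.Icc (0 : ℝ) 1) {f g : Finset E → Finset E → ℝ}
    (h : ∀ S ⊆ F, ∀ T ⊆ F, f S T ≤ g S T) : expect₂ F p f ≤ expect₂ F p g :=
  expect_mono hp fun S hS => expect_mono hp fun T hT => h S hS T hT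

lemma expect₂_add (f g : Finset E → Finset E → ℝ) :
    expect₂ F p (fun S T => f S T + g S T) = expect₂ F p f + expect₂ F p g := by
  simp only [expect₂, expect_add]

lemma expect₂_const_mul (c : ℝ) (f : Finset E → Finset E → ℝ) :
    expect₂ F p (fun S T => c * f S T) = c * expect₂ F p f := by
  simp only [expect₂, expect_const_mul]

lemma expect₂_mul (f g : Finset E → ℝ) :
    expect₂ F p (fun S T => f S * g T) = expect F p f * expect F p g := by
  simp only [expect₂, expect_const_mul, expect_mul_const]

lemma expect₂_nonneg (hp : ∀ e, p e ∈ Set.Icc (0 : ℝ) 1) {f : Finset E → Finset E → ℝ}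
    (h : ∀ S T, 0 ≤ f S T) : 0 ≤ expect₂ F p f :=
  expect_nonneg hp fun S => expect_nonneg hp fun T => h S T

lemma expect₂_split {e : E} (he : e ∈ F) (f : Finset E → Finset E → ℝ) :
    expect₂ F p f = expect₂ F p fun S T =>
      p e * (p e * f (insert e S) (insert e T) + (1 - p e) * f (insert e S) (T.erase e)) +
      (1 - p e) * (p e * f (S.erase e) (insert e T) + (1 - p e) * f (S.erase e) (T.erase e)) := by
  rw [expect₂, expect_split he]
  simp only [expect₂, expect_add, expect_const_mul]
  simp only [← expect_const_mul, ← expect_add]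
  congr 1
  funext S
  rw [expect_split he]
  simp only [expect_const_mul, expect_add]
  ring

lemma finProb_nonneg (hp : ∀ e, p e ∈ Set.Icc (0 : ℝ) 1) (A : Finset E → Prop) :
    0 ≤ finProb F p A := expect_nonneg hp fun _ => ind_nonneg _

lemma finProb_eq_one {A : Finset E → Prop} (h : ∀ T, A T) : finProb F p A = 1 := by
  rw [finProb]
  simp only [ind_of_true (h _)]
  exact expect_one

lemma finProb_eq_zero {A : Finset E → Prop} (h : ∀ T ⊆ F, ¬ A T) : finProb F p A = 0 :=
  Finset.sum_eq_zero fun T hT => by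
    simp only [ind_of_false (h T (Finset.mem_powerset.1 hT)), mul_zero]

/-- The probability of `A` given that the elements of `O` are open and those of `C` closed. -/
noncomputable def condProb (F : Finset E) (p : E → ℝ) (A : Finset E → Prop) (O C : Finset E) : ℝ :=
  finProb F p fun T => A (T \ C ∪ O)

lemma condProb_empty (A : Finset E → Prop) : condProb F p A ∅ ∅ = finProb F p A := by
  simp [condProb]

lemma condProb_nonneg (hp : ∀ e, p e ∈ Set.Icc (0 : ℝ) 1) (A : Finset E → Prop)
    (O C : Finset E) : 0 ≤ condProb F p A O C := finProb_nonneg hp _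

lemma condProb_split (A : Finset E → Prop) {O C : Finset E} {e : E} (he : e ∈ F)
    (hC : e ∉ C) : condProb F p A O C =
      p e * condProb F p A (insert e O) C + (1 - p e) * condProb F p A O (insert e C) := by
  rw [condProb, finProb, expect_split he]
  have h1 : ∀ T : Finset E, insert e T \ C ∪ O = T \ C ∪ insert e O := by
    intro T; ext x; simp only [Finset.mem_union, Finset.mem_sdiff, Finset.mem_insert]; grind
  have h2 : ∀ T : Finset E, T.erase e \ C ∪ O = T \ insert e C ∪ O := by
    intro T; ext x; simp only [Finset.mem_union, Finset.mem_sdiff, Finset.mem_insert,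
      Finset.mem_erase]; grind
  simp only [h1, h2]
  rfl

/-- `A` and `B` occur in two configurations that share the open set `O`, each element of `O`
being used in at most one of them. -/
def SplitOccur (A B : Finset E → Prop) (O C S T : Finset E) : Prop :=
  ∃ K L, K ⊆ O ∧ L ⊆ O ∧ Disjoint K L ∧ A (S \ (O ∪ C) ∪ K) ∧ B (T \ (O ∪ C) ∪ L)

lemma SplitOccur.mono {A B : Finset E → Prop} (hA : Monotone A) (hB : Monotone B)
    {O C S T S' T' : Finset E} (hS : S ⊆ S') (hT : T ⊆ T') :
    SplitOccur A B O C S T → SplitOccur A B O C S' T' := by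
  rintro ⟨K, L, hK, hL, hd, hAK, hBL⟩
  exact ⟨K, L, hK, hL, hd,
    hA (Finset.union_subset_union_left (Finset.sdiff_subset_sdiff hS subset_rfl)) hAK,
    hB (Finset.union_subset_union_left (Finset.sdiff_subset_sdiff hT subset_rfl)) hBL⟩

/-- At most one of the two events uses the shared element `e`. Giving `e` to that side's own
configuration and closing it on the other side loses nothing, by monotonicity. -/
lemma SplitOccur.of_insert_open {A B : Finset E → Prop} (hA : Monotone A) (hB : Monotone B)
    {O C S T : Finset E} {e : E} (hO : e ∉ O) (hC : e ∉ C)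
    (h : SplitOccur A B (insert e O) C S T) :
    SplitOccur A B O C (insert e S) (T.erase e) ∨ SplitOccur A B O C (S.erase e) (insert e T) := by
  obtain ⟨K, L, hK, hL, hd, hAK, hBL⟩ := h
  have hd' := Finset.disjoint_left.1 hd
  by_cases heK : e ∈ K
  · refine .inl ⟨K.erase e, L, ?_, ?_, ?_, hA ?_ hAK, hB ?_ hBL⟩
    · intro x hx; have := hK (Finset.mem_of_mem_erase hx); grind
    · intro x hx; have := hL hx; have := hd' heK; grind
    · exact hd.mono_left (Finset.erase_subset _ _)
    · intro x; simp only [Finset.mem_union, Finset.mem_sdiff, Finset.mem_insert,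
        Finset.mem_erase]; grind
    · intro x; simp only [Finset.mem_union, Finset.mem_sdiff, Finset.mem_insert,
        Finset.mem_erase]; grind
  · refine .inr ⟨K, L.erase e, ?_, ?_, ?_, hA ?_ hAK, hB ?_ hBL⟩
    · intro x hx; have := hK hx; grind
    · intro x hx; have := hL (Finset.mem_of_mem_erase hx); grind
    · exact hd.mono_right (Finset.erase_subset _ _)
    · intro x; simp only [Finset.mem_union, Finset.mem_sdiff, Finset.mem_insert,
        Finset.mem_erase]; grind
    · intro x; simp only [Finset.mem_union, Finset.mem_sdiff, Finset.mem_insert,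
        Finset.mem_erase]; grind

lemma SplitOccur.of_insert_closed {A B : Finset E → Prop} (hA : Monotone A) (hB : Monotone B)
    {O C S T : Finset E} {e : E} (h : SplitOccur A B O (insert e C) S T) :
    SplitOccur A B O C (S.erase e) (T.erase e) := by
  obtain ⟨K, L, hK, hL, hd, hAK, hBL⟩ := h
  refine ⟨K, L, hK, hL, hd, hA ?_ hAK, hB ?_ hBL⟩ <;>
  · intro x; simp only [Finset.mem_union, Finset.mem_sdiff, Finset.mem_insert,
      Finset.mem_erase]; grind

/-- The probability of `SplitOccur` for two independent random sets. -/
noncomputable def splitProb (F : Finset E) (p : E → ℝ) (A B : Finset E → Prop)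
    (O C : Finset E) : ℝ :=
  expect₂ F p fun S T => ind (SplitOccur A B O C S T)

lemma splitProb_nonneg (hp : ∀ e, p e ∈ Set.Icc (0 : ℝ) 1) (A B : Finset E → Prop)
    (O C : Finset E) : 0 ≤ splitProb F p A B O C := expect₂_nonneg hp fun _ _ => ind_nonneg _

lemma splitProb_mono (hp : ∀ e, p e ∈ Set.Icc (0 : ℝ) 1) {A B A' B' : Finset E → Prop}
    (hA : ∀ S, A S → A' S) (hB : ∀ S, B S → B' S) (O C : Finset E) :
    splitProb F p A B O C ≤ splitProb F p A' B' O C :=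
  expect₂_mono hp fun _ _ _ _ => ind_mono fun ⟨K, L, hK, hL, hd, h1, h2⟩ =>
    ⟨K, L, hK, hL, hd, hA _ h1, hB _ h2⟩

lemma splitProb_empty (A B : Finset E → Prop) :
    splitProb F p A B ∅ ∅ = finProb F p A * finProb F p B := by
  rw [finProb, finProb, ← expect₂_mul, splitProb]
  congr 1
  funext S T
  have : SplitOccur A B ∅ ∅ S T ↔ A S ∧ B T := by
    simp [SplitOccur, Finset.subset_empty]
  by_cases h1 : A S <;> by_cases h2 : B T <;> simp [ind, this, h1, h2]

/-- The van den Berg–Kesten step: sharing an explored element between the two configurations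
does not increase the probability. -/
lemma splitProb_split (hp : ∀ e, p e ∈ Set.Icc (0 : ℝ) 1) {A B : Finset E → Prop}
    (hA : Monotone A) (hB : Monotone B) {O C : Finset E} {e : E} (he : e ∈ F) (hO : e ∉ O)
    (hC : e ∉ C) :
    p e * splitProb F p A B (insert e O) C + (1 - p e) * splitProb F p A B O (insert e C) ≤
      splitProb F p A B O C := by
  rw [splitProb, splitProb, splitProb, expect₂_split he (fun S T => ind (SplitOccur A B O C S T)),
    ← expect₂_const_mul, ← expect₂_const_mul, ← expect₂_add]
  refine expect₂_mono hp fun S _ T _ => ?_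
  have hu := SplitOccur.of_insert_open hA hB hO hC (S := S) (T := T)
  have hz := SplitOccur.of_insert_closed hA hB (O := O) (C := C) (S := S) (T := T) (e := e)
  have hS : S.erase e ⊆ insert e S := (Finset.erase_subset _ _).trans (Finset.subset_insert _ _)
  have hT : T.erase e ⊆ insert e T := (Finset.erase_subset _ _).trans (Finset.subset_insert _ _)
  have m1 := SplitOccur.mono hA hB (O := O) (C := C) hS (subset_refl (T.erase e))
  have m2 := SplitOccur.mono hA hB (O := O) (C := C) (subset_refl (S.erase e)) hT
  have m3 := SplitOccur.mono hA hB (O := O) (C := C) (subset_refl (insert e S)) hT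
  have m4 := SplitOccur.mono hA hB (O := O) (C := C) hS (subset_refl (insert e T))
  generalize SplitOccur A B (insert e O) C S T = u at *
  generalize SplitOccur A B O (insert e C) S T = z at *
  generalize SplitOccur A B O C (insert e S) (insert e T) = w11 at *
  generalize SplitOccur A B O C (insert e S) (T.erase e) = w10 at *
  generalize SplitOccur A B O C (S.erase e) (insert e T) = w01 at *
  generalize SplitOccur A B O C (S.erase e) (T.erase e) = w00 at *
  obtain ⟨h0, h1⟩ := hp e
  have hu' := ind_mono hu
  have hz' := ind_mono hz
  refine (add_le_add (mul_le_mul_of_nonneg_left hu' h0)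
    (mul_le_mul_of_nonneg_left hz' (sub_nonneg.2 h1))).trans ?_
  -- With `q` the probability of `e`: if `w00` holds, the right side is 1. Otherwise the left side
  -- is at most `q`, and 0 unless `w10` or `w01` holds; one of these together with `w11` already
  -- contributes `q * q + q * (1 - q) = q`.
  by_cases c00 : w00
  · simp [ind, c00, m1 c00, m2 c00, m3 (m1 c00)]
  · by_cases c10 : w10 <;> by_cases c01 : w01
    · simp [ind, c00, c10, c01, m3 c10]; nlinarith
    · simp [ind, c00, c10, c01, m3 c10]
    · simp [ind, c00, c10, c01, m4 c01]; nlinarith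
    · simp [ind, c00, c10, c01]
      split_ifs <;> simp [mul_self_nonneg]

/-- States `(O, C)` of explored open and closed elements from which some exploration strategy
always ends in a state satisfying `L`. -/
inductive Explorable (F : Finset E) (L : Finset E → Finset E → Prop) :
    Finset E → Finset E → Prop
  | done {O C} (h : L O C) : Explorable F L O C
  | query {O C} (e : E) (he : e ∈ F) (hO : e ∉ O) (hC : e ∉ C)
      (h1 : Explorable F L (insert e O) C) (h0 : Explorable F L O (insert e C)) :
      Explorable F L O C

/-- Two-point Cauchy–Schwarz, which propagates a bound `x ^ 2 ≤ h * Y` through averaging over one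
query. -/
lemma sq_convex_comb_le {t x y h k Y Z : ℝ} (ht : 0 ≤ t) (ht' : 0 ≤ 1 - t)
    (hh : 0 ≤ h) (hk : 0 ≤ k) (hY : 0 ≤ Y) (hZ : 0 ≤ Z)
    (h1 : x ^ 2 ≤ h * Y) (h2 : y ^ 2 ≤ k * Z) :
    (t * x + (1 - t) * y) ^ 2 ≤ (t * h + (1 - t) * k) * (t * Y + (1 - t) * Z) := by
  -- The cross term, by AM–GM: `(x * y) ^ 2 ≤ (h * Z) * (k * Y)`.
  have h3 : 2 * (x * y) ≤ h * Z + k * Y := by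
    have e1 : (x * y) ^ 2 ≤ (h * Z) * (k * Y) := by
      calc (x * y) ^ 2 = x ^ 2 * y ^ 2 := by ring
        _ ≤ (h * Y) * (k * Z) := mul_le_mul h1 h2 (sq_nonneg _) (mul_nonneg hh hY)
        _ = _ := by ring
    refine le_of_sq_le_sq ?_ (by positivity)
    nlinarith [sq_nonneg (h * Z - k * Y)]
  nlinarith [mul_le_mul_of_nonneg_left h1 (mul_nonneg ht ht),
    mul_le_mul_of_nonneg_left h2 (mul_nonneg ht' ht'),
    mul_le_mul_of_nonneg_left h3 (mul_nonneg ht ht')]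

end Expectation

/-! ### Depth-first exploration of a cluster. -/

section Exploration

variable {V E : Type*} (ι : E → Sym2 V)

/-- Connection by a path of elements of `T`, where `ι` gives the endpoints of each element. -/
def Conn (T : Finset E) : V → V → Prop :=
  Relation.ReflTransGen fun u v => ∃ e ∈ T, ι e = s(u, v)

variable {ι}

lemma Conn.mono {S T : Finset E} (h : S ⊆ T) {u v : V} : Conn ι S u v → Conn ι T u v :=
  Relation.ReflTransGen.mono (fun _ _ ⟨e, he, h'⟩ => ⟨e, h he, h'⟩) u v

lemma Conn.symm {T : Finset E} {u v : V} (h : Conn ι T u v) : Conn ι T v u := by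
  have : Std.Symm (fun u v => ∃ e ∈ T, ι e = s(u, v)) :=
    ⟨fun _ _ ⟨e, he, h'⟩ => ⟨e, he, h'.trans Sym2.eq_swap⟩⟩
  exact (inferInstance : Std.Symm (Relation.ReflTransGen
    (fun u v => ∃ e ∈ T, ι e = s(u, v)))).symm _ _ h

lemma Conn.trans {T : Finset E} {u v w : V} (h : Conn ι T u v) (h' : Conn ι T v w) :
    Conn ι T u w := Relation.ReflTransGen.trans h h'

lemma Conn.refl (T : Finset E) (u : V) : Conn ι T u u := Relation.ReflTransGen.refl

lemma Conn.single {T : Finset E} {e : E} (he : e ∈ T) {u v : V} (h : ι e = s(u, v)) :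
    Conn ι T u v := Relation.ReflTransGen.single ⟨e, he, h⟩

lemma Conn.monotone (u v : V) : Monotone fun T : Finset E => Conn ι T u v :=
  fun _ _ h => Conn.mono h

variable (ι) in
/-- Disjoint parts of `O` connect `a` to `x` and `t` to `y`. -/
def SplitConn (O : Finset E) (a t x y : V) : Prop :=
  ∃ K L, K ⊆ O ∧ L ⊆ O ∧ Disjoint K L ∧ Conn ι K a x ∧ Conn ι L t y

lemma SplitConn.mono {O O' : Finset E} (h : O ⊆ O') {a t x y : V} :
    SplitConn ι O a t x y → SplitConn ι O' a t x y :=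
  fun ⟨K, L, hK, hL, h'⟩ => ⟨K, L, hK.trans h, hL.trans h, h'⟩

lemma SplitConn.conn {O : Finset E} {a t x y : V} : SplitConn ι O a t x y → Conn ι O a x :=
  fun ⟨_, _, hK, _, _, h, _⟩ => h.mono hK

variable (ι) in
/-- The vertices of `l` lie on a path from `a` to `t` in `O`, in the sense that any two of
them (possibly equal) can be reached disjointly from the two ends, in one of the two orders. -/
def OnPath (O : Finset E) (a t : V) (l : List V) : Prop :=
  ∀ x ∈ l, ∀ y ∈ l, SplitConn ι O a t x y ∨ SplitConn ι O a t y x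

variable (ι) in
/-- The invariant of the stack of a depth-first exploration started at `a`. -/
def IsStack (O : Finset E) (a : V) : List V → Prop
  | [] => True
  | t :: l => IsStack O a l ∧ OnPath ι O a t (t :: l)

lemma IsStack.mono {O O' : Finset E} (h : O ⊆ O') {a : V} :
    ∀ {l : List V}, IsStack ι O a l → IsStack ι O' a l
  | [], _ => trivial
  | _ :: _, ⟨h1, h2⟩ => ⟨h1.mono h, fun x hx y hy => (h2 x hx y hy).imp (.mono h) (.mono h)⟩

variable [DecidableEq E]

/-- Since `e` is fresh, it can be added to the piece at the `t` end without meeting the piece at the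
`a` end. For a pair containing the new endpoint `w`, the piece at the far end is empty. -/
lemma OnPath.push {O : Finset E} {a t w : V} {l : List V} {e : E} (he : e ∉ O)
    (hew : ι e = s(t, w)) (h : OnPath ι O a t (t :: l)) :
    OnPath ι (insert e O) a w (w :: t :: l) := by
  have ext_right : ∀ {x y}, SplitConn ι O a t x y → SplitConn ι (insert e O) a w x y := by
    rintro x y ⟨K, L, hK, hL, hd, h1, h2⟩
    refine ⟨K, insert e L, hK.trans (Finset.subset_insert _ _), Finset.insert_subset_insert _ hL,
      ?_, h1, ?_⟩
    · exact Finset.disjoint_insert_right.2 ⟨fun h => he (hK h), hd⟩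
    · exact (Conn.single (Finset.mem_insert_self e L) (hew.trans Sym2.eq_swap)).trans
        (h2.mono (Finset.subset_insert _ _))
  have drop_right : ∀ {x}, Conn ι O a x → SplitConn ι (insert e O) a w x w := fun {x} h1 =>
    ⟨O, ∅, Finset.subset_insert _ _, Finset.empty_subset _, Finset.disjoint_empty_right _, h1,
      Conn.refl _ _⟩
  have hconn : ∀ x ∈ t :: l, Conn ι O a x := fun x hx => (h x hx x hx).elim (·.conn) (·.conn)
  intro x hx y hy
  rcases List.mem_cons.1 hx with rfl | hx' <;> rcases List.mem_cons.1 hy with rfl | hy'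
  · left
    refine ⟨insert e O, ∅, subset_rfl, Finset.empty_subset _, Finset.disjoint_empty_right _, ?_,
      Conn.refl _ _⟩
    exact ((hconn t List.mem_cons_self).mono (Finset.subset_insert _ _)).trans
      (Conn.single (Finset.mem_insert_self e O) hew)
  · exact .inr (drop_right (hconn y hy'))
  · exact .inl (drop_right (hconn x hx'))
  · exact (h x hx' y hy').imp ext_right ext_right

variable (ι) in
/-- `S` is a set of visited vertices for the explored open set `O`, and all elements of `F`
leaving `S` from a vertex outside `l` are explored and closed. -/
structure IsFrontier (F : Finset E) (O C : Finset E) (S : Set V) (l : List V) : Prop where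
  inside : ∀ e ∈ O, ∀ u v, ι e = s(u, v) → u ∈ S
  closed : ∀ e ∈ F, ∀ u v, ι e = s(u, v) → u ∈ S → v ∉ S → u ∉ l → e ∈ C

variable (ι) in
/-- The exploration has exhausted the cluster of `a` without visiting `b`. -/
def Exhausted (F : Finset E) (a b : V) (O C : Finset E) : Prop :=
  ∃ S : Set V, a ∈ S ∧ b ∉ S ∧ IsFrontier ι F O C S []

variable (ι) in
/-- The exploration has found a path from `a` to `b` and has not visited `c`. -/
def Found (F : Finset E) (a b c : V) (O C : Finset E) : Prop :=
  ∃ (S : Set V) (l : List V), b ∈ S ∧ c ∉ S ∧ b ∈ l ∧ IsFrontier ι F O C S l ∧ OnPath ι O a b l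

/-- Depth-first search from the top of the stack `l`. -/
lemma explorable_of_isStack {F : Finset E} {a b c : V} (hbc : b ≠ c) {O C : Finset E} {S : Set V}
    {l : List V} (ha : a ∈ S) (hb : b ∉ S) (hc : c ∉ S) (hS : ∀ x ∈ l, x ∈ S)
    (hfr : IsFrontier ι F O C S l) (hst : IsStack ι O a l) :
    Explorable F (fun O C => Exhausted ι F a b O C ∨ Found ι F a b c O C ∨ Found ι F a c b O C)
      O C := by
  -- A query decreases the number of unexplored elements. A pop does not, hence the inner induction
  -- on the stack.
  induction hn : (F \ (O ∪ C)).card using Nat.strong_induction_on generalizing O C S l with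
  | _ n ih =>
  subst hn
  induction l with
  | nil => exact .done (.inl ⟨S, ha, hb, hfr⟩)
  | cons t l ihl =>
    by_cases hex : ∃ e ∈ F, e ∉ C ∧ ∃ w ∉ S, ι e = s(t, w)
    · obtain ⟨e, he, heC, w, hw, hew⟩ := hex
      have heO : e ∉ O := fun h => hw (hfr.inside e h w t (hew.trans Sym2.eq_swap))
      have hlt : ∀ {U : Finset E}, O ∪ C ⊆ U → e ∈ U → (F \ U).card < (F \ (O ∪ C)).card := by
        intro U hU heU
        refine Finset.card_lt_card ⟨Finset.sdiff_subset_sdiff subset_rfl hU, fun h => ?_⟩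
        have := h (Finset.mem_sdiff.2 ⟨he, by simp [heO, heC]⟩)
        exact (Finset.mem_sdiff.1 this).2 heU
      have htS : t ∈ S := hS t List.mem_cons_self
      refine .query e he heO heC ?_ ?_
      · have hfr' : IsFrontier ι F (insert e O) C (insert w S) (w :: t :: l) := by
          refine ⟨fun e' he' u v huv => ?_, fun e' he' u v huv hu hv hul => ?_⟩
          · rcases Finset.mem_insert.1 he' with rfl | he'
            · have : u ∈ s(t, w) := by rw [← hew, huv]; simp
              rcases Sym2.mem_iff.1 this with rfl | rfl
              · exact .inr htS
              · exact .inl rfl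
            · exact .inr (hfr.inside e' he' u v huv)
          · have huw : u ≠ w := fun h => hul (h ▸ List.mem_cons_self)
            exact hfr.closed e' he' u v huv (hu.resolve_left huw) (fun h => hv (.inr h))
              fun h => hul (List.mem_cons_of_mem _ h)
        have hp := hst.2.push heO hew
        by_cases hwb : w = b
        · subst hwb
          refine .done (.inr (.inl ⟨_, _, .inl rfl, ?_, List.mem_cons_self, hfr', hp⟩))
          rintro (h | h)
          exacts [hbc h.symm, hc h]
        by_cases hwc : w = c
        · subst hwc
          refine .done (.inr (.inr ⟨_, _, .inl rfl, ?_, List.mem_cons_self, hfr', hp⟩))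
          rintro (h | h)
          exacts [hbc h, hb h]
        refine ih _ (hlt (U := insert e O ∪ C) ?_ (by simp)) (.inr ha) ?_ ?_ ?_ hfr'
          ⟨hst.mono (Finset.subset_insert _ _), hp⟩ rfl
        · exact Finset.union_subset_union_left (Finset.subset_insert _ _)
        · rintro (h | h)
          exacts [hwb h.symm, hb h]
        · rintro (h | h)
          exacts [hwc h.symm, hc h]
        · intro x hx
          rcases List.mem_cons.1 hx with rfl | hx
          exacts [.inl rfl, .inr (hS x hx)]
      · refine ih _ (hlt (U := O ∪ insert e C) ?_ (by simp)) ha hb hc hS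
          ⟨hfr.inside, fun e' he' u v huv hu hv hul =>
            Finset.mem_insert_of_mem (hfr.closed e' he' u v huv hu hv hul)⟩ hst rfl
        exact Finset.union_subset_union_right (Finset.subset_insert _ _)
    -- Backtracking: all elements from `t` out of `S` are closed, so `t` may leave the stack without
    -- spoiling the frontier.
    · refine ihl (fun x hx => hS x (List.mem_cons_of_mem _ hx)) ⟨hfr.inside, ?_⟩ hst.1
      intro e he u v huv hu hv hul
      by_contra heC
      by_cases hut : u = t
      · exact hex ⟨e, he, heC, v, hv, hut ▸ huv⟩
      · exact heC (hfr.closed e he u v huv hu hv (by simp [hut, hul]))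

lemma explorable_empty (F : Finset E) {a b c : V} (hab : a ≠ b) (hac : a ≠ c) (hbc : b ≠ c) :
    Explorable F (fun O C => Exhausted ι F a b O C ∨ Found ι F a b c O C ∨ Found ι F a c b O C)
      ∅ ∅ := by
  refine explorable_of_isStack hbc (S := {a}) (l := [a]) rfl hab.symm hac.symm (by simp)
    ⟨by simp, ?_⟩ ⟨trivial, ?_⟩
  · intro e _ u v _ hu _ hul
    exact absurd (List.mem_singleton.2 hu) hul
  · intro x hx y hy
    obtain rfl := List.mem_singleton.1 hx
    obtain rfl := List.mem_singleton.1 hy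
    exact .inl ⟨∅, ∅, subset_rfl, subset_rfl, Finset.disjoint_empty_right _, Conn.refl _ _,
      Conn.refl _ _⟩

/-- A connection to `S` from outside enters `S` at a vertex of the frontier and uses unexplored
elements before that. -/
lemma IsFrontier.exists_conn {F O C T : Finset E} {S : Set V} {l : List V}
    (h : IsFrontier ι F O C S l) (hT : T ⊆ F) {u v : V} (hu : u ∉ S) (hv : v ∈ S)
    (huv : Conn ι (T \ C ∪ O) u v) : ∃ x ∈ l, Conn ι (T \ (O ∪ C)) u x := by
  induction huv using Relation.ReflTransGen.head_induction_on with
  | refl => exact absurd hv hu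
  | @head u w huw _ ih =>
    obtain ⟨e, he, hew⟩ := huw
    have heO : e ∉ O := fun h' => hu (h.inside e h' u w hew)
    obtain ⟨heT, heC⟩ : e ∈ T ∧ e ∉ C :=
      Finset.mem_sdiff.1 ((Finset.mem_union.1 he).resolve_right heO)
    have hst : Conn ι (T \ (O ∪ C)) u w := Conn.single (by simp [heT, heO, heC]) hew
    by_cases hw : w ∈ S
    · refine ⟨w, ?_, hst⟩
      -- The first step into `S` uses an element that is not in `C`, so it can only land on the
      -- stack.
      by_contra hwl
      exact heC (h.closed e (hT heT) w u (hew.trans Sym2.eq_swap) hw hu hwl)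
    · obtain ⟨x, hx, hwx⟩ := ih hw
      exact ⟨x, hx, hst.trans hwx⟩

/-- With an empty stack there is no vertex through which a connection from `b` could enter `S`. -/
lemma Exhausted.condProb_eq_zero {F O C : Finset E} {a b : V} (h : Exhausted ι F a b O C)
    (p : E → ℝ) {A : Finset E → Prop} (hA : ∀ T, A T → Conn ι T a b) :
    condProb F p A O C = 0 := by
  obtain ⟨S, ha, hb, hfr⟩ := h
  refine finProb_eq_zero fun T hT hAT => ?_
  obtain ⟨x, hx, -⟩ := hfr.exists_conn hT hb ha (hA _ hAT).symm
  exact absurd hx List.not_mem_nil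

lemma Found.condProb_eq_one {F O C : Finset E} {a b c : V} (h : Found ι F a b c O C)
    (p : E → ℝ) {A : Finset E → Prop} (hA : ∀ T, Conn ι T a b → A T) :
    condProb F p A O C = 1 := by
  obtain ⟨S, l, -, -, hbl, -, hl⟩ := h
  have : Conn ι O a b := (hl b hbl b hbl).elim (·.conn) (·.conn)
  exact finProb_eq_one fun T => hA _ (this.mono Finset.subset_union_right)

/-- The square is the probability that two independent copies both connect `c` to the stack, at `x`
and `y`. Cutting the explored path between these vertices produces the split event. The factor 2
accounts for the two possible orders of `x` and `y`. -/
lemma Found.sq_condProb_le {F O C : Finset E} {a b c : V} (h : Found ι F a b c O C)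
    {p : E → ℝ} (hp : ∀ e, p e ∈ Set.Icc (0 : ℝ) 1) {A : Finset E → Prop}
    (hA : ∀ T, A T → Conn ι T b c) :
    condProb F p A O C ^ 2 ≤
      2 * splitProb F p (fun T => Conn ι T a c) (fun T => Conn ι T b c) O C := by
  obtain ⟨S, l, hb, hc, -, hfr, hl⟩ := h
  set W := SplitOccur (fun T => Conn ι T a c) (fun T => Conn ι T b c) O C with hW
  have key : ∀ {X Y x y}, Conn ι (X \ (O ∪ C)) c x → Conn ι (Y \ (O ∪ C)) c y →
      SplitConn ι O a b x y → W X Y := by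
    rintro X Y x y hx hy ⟨K, L, hK, hL, hd, h1, h2⟩
    exact ⟨K, L, hK, hL, hd,
      (h1.mono Finset.subset_union_right).trans (hx.symm.mono Finset.subset_union_left),
      (h2.mono Finset.subset_union_right).trans (hy.symm.mono Finset.subset_union_left)⟩
  have hsq : condProb F p A O C ^ 2 =
      expect₂ F p fun X Y => ind (A (X \ C ∪ O)) * ind (A (Y \ C ∪ O)) := by
    rw [expect₂_mul (fun X => ind (A (X \ C ∪ O))) (fun X => ind (A (X \ C ∪ O))), sq]
    rfl
  -- The reverse order of `x` and `y` gives `W` with the copies exchanged, which has the same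
  -- probability.
  have hswap : expect₂ F p (fun X Y => ind (W Y X)) = expect₂ F p (fun X Y => ind (W X Y)) :=
    expect_comm _
  rw [hsq, splitProb, two_mul]
  nth_rewrite 2 [← hswap]
  rw [← expect₂_add]
  refine expect₂_mono hp fun X hX Y hY => ?_
  by_cases hAX : A (X \ C ∪ O)
  swap
  · rw [ind_of_false hAX, zero_mul]
    exact add_nonneg (ind_nonneg _) (ind_nonneg _)
  by_cases hAY : A (Y \ C ∪ O)
  swap
  · rw [ind_of_false hAY, mul_zero]
    exact add_nonneg (ind_nonneg _) (ind_nonneg _)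
  rw [ind_of_true hAX, ind_of_true hAY, one_mul]
  obtain ⟨x, hx, hcx⟩ := hfr.exists_conn hX hc hb (hA _ hAX).symm
  obtain ⟨y, hy, hcy⟩ := hfr.exists_conn hY hc hb (hA _ hAY).symm
  rcases hl x hx y hy with h | h
  · rw [ind_of_true (key hcx hcy h)]
    exact le_add_of_nonneg_right (ind_nonneg _)
  · rw [ind_of_true (key hcy hcx h)]
    exact le_add_of_nonneg_left (ind_nonneg _)

/-! ### The two inequalities in finite volume. -/

/-- Passing a quadratic bound from the two outcomes of a query to the state before it. -/
lemma sq_le_of_query {F : Finset E} {p : E → ℝ} (hp : ∀ e, p e ∈ Set.Icc (0 : ℝ) 1)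
    {A B H : Finset E → Prop} (hA : Monotone A) (hB : Monotone B) {O C : Finset E} {e : E}
    (he : e ∈ F) (hO : e ∉ O) (hC : e ∉ C) {x y : ℝ}
    (h1 : x ^ 2 ≤ condProb F p H (insert e O) C * (2 * splitProb F p A B (insert e O) C))
    (h0 : y ^ 2 ≤ condProb F p H O (insert e C) * (2 * splitProb F p A B O (insert e C))) :
    (p e * x + (1 - p e) * y) ^ 2 ≤ condProb F p H O C * (2 * splitProb F p A B O C) := by
  have hn := fun O C => mul_nonneg zero_le_two (splitProb_nonneg (F := F) hp A B O C)
  refine (sq_convex_comb_le (hp e).1 (sub_nonneg.2 (hp e).2) (condProb_nonneg hp H _ _)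
    (condProb_nonneg hp H _ _) (hn _ _) (hn _ _) h1 h0).trans ?_
  rw [← condProb_split H he hC]
  refine mul_le_mul_of_nonneg_left ?_ (condProb_nonneg hp H _ _)
  linarith [splitProb_split hp hA hB he hO hC]

/-- The bound on the three-point connection probability in a finite set of edges by the
probabilities that `a` is connected to one of `b` and `c` and that `b` is connected to `c`. -/
theorem sq_finProb_le_two_mul (F : Finset E) {p : E → ℝ} (hp : ∀ e, p e ∈ Set.Icc (0 : ℝ) 1)
    {a b c : V} (hab : a ≠ b) (hac : a ≠ c) (hbc : b ≠ c) :
    finProb F p (fun T => Conn ι T a b ∧ Conn ι T a c) ^ 2 ≤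
      2 * finProb F p (fun T => Conn ι T a b ∨ Conn ι T a c) ^ 2 *
        finProb F p (fun T => Conn ι T b c) := by
  set G := fun T : Finset E => Conn ι T a b ∧ Conn ι T a c
  set H := fun T : Finset E => Conn ι T a b ∨ Conn ι T a c
  have hH : Monotone H := fun _ _ h => Or.imp (.mono h) (.mono h)
  -- `H` is certain once either vertex is found, and it contains both `ac` and `ab`, so it serves in
  -- both factors whichever vertex comes first.
  have main : ∀ {O C}, Explorable F (fun O C => Exhausted ι F a b O C ∨ Found ι F a b c O C ∨
      Found ι F a c b O C) O C → condProb F p G O C ^ 2 ≤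
        condProb F p H O C * (2 * splitProb F p H (fun T => Conn ι T b c) O C) := by
    intro O C h
    induction h with
    | done h =>
      rcases h with h | h | h
      · rw [h.condProb_eq_zero p fun _ h => h.1, zero_pow two_ne_zero]
        exact mul_nonneg (condProb_nonneg hp _ _ _)
          (mul_nonneg zero_le_two (splitProb_nonneg hp _ _ _ _))
      · rw [h.condProb_eq_one p (A := H) fun _ h => .inl h, one_mul]
        refine (h.sq_condProb_le hp fun _ h => h.1.symm.trans h.2).trans
          (mul_le_mul_of_nonneg_left ?_ zero_le_two)
        exact splitProb_mono hp (fun _ h => .inr h) (fun _ h => h) _ _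
      · rw [h.condProb_eq_one p (A := H) fun _ h => .inr h, one_mul]
        refine (h.sq_condProb_le hp fun _ h => h.2.symm.trans h.1).trans
          (mul_le_mul_of_nonneg_left ?_ zero_le_two)
        exact splitProb_mono hp (fun _ h => .inl h) (fun _ h => h.symm) _ _
    | query e he hO hC _ _ ih1 ih0 =>
      rw [condProb_split G he hC]
      exact sq_le_of_query hp hH (Conn.monotone b c) he hO hC ih1 ih0
  have := main (explorable_empty F hab hac hbc)
  rw [condProb_empty, condProb_empty, splitProb_empty] at this
  linarith

/-- The bound on the three-point connection probability in a finite set of edges by the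
product of the two-point connection probabilities. -/
theorem sq_finProb_le_eight_mul (F : Finset E) {p : E → ℝ} (hp : ∀ e, p e ∈ Set.Icc (0 : ℝ) 1)
    {a b c : V} (hab : a ≠ b) (hac : a ≠ c) (hbc : b ≠ c) :
    finProb F p (fun T => Conn ι T a b ∧ Conn ι T a c) ^ 2 ≤
      8 * finProb F p (fun T => Conn ι T a b) * finProb F p (fun T => Conn ι T a c) *
        finProb F p (fun T => Conn ι T b c) := by
  set G := fun T : Finset E => Conn ι T a b ∧ Conn ι T a c
  -- `x` and `y` collect the contributions of the runs that find `b` first and `c` first; they need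
  -- different bounds, so they are carried separately.
  have main : ∀ {O C}, Explorable F (fun O C => Exhausted ι F a b O C ∨ Found ι F a b c O C ∨
      Found ι F a c b O C) O C → ∃ x y, condProb F p G O C ≤ x + y ∧
        x ^ 2 ≤ condProb F p (fun T => Conn ι T a b) O C *
          (2 * splitProb F p (fun T => Conn ι T a c) (fun T => Conn ι T b c) O C) ∧
        y ^ 2 ≤ condProb F p (fun T => Conn ι T a c) O C *
          (2 * splitProb F p (fun T => Conn ι T a b) (fun T => Conn ι T c b) O C) := by
    intro O C h
    have hn := fun (A A' B' : Finset E → Prop) (O C : Finset E) =>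
      mul_nonneg (condProb_nonneg (F := F) hp A O C)
        (mul_nonneg zero_le_two (splitProb_nonneg (F := F) hp A' B' O C))
    induction h with
    | done h =>
      rcases h with h | h | h
      · refine ⟨0, 0, ?_, ?_, ?_⟩
        · rw [h.condProb_eq_zero p fun _ h => h.1, add_zero]
        · simpa using hn _ _ _ _ _
        · simpa using hn _ _ _ _ _
      · refine ⟨_, 0, (add_zero _).ge, ?_, by simpa using hn _ _ _ _ _⟩
        rw [h.condProb_eq_one p fun _ h => h, one_mul]
        exact h.sq_condProb_le hp fun _ h => h.1.symm.trans h.2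
      · refine ⟨0, _, (zero_add _).ge, by simpa using hn _ _ _ _ _, ?_⟩
        rw [h.condProb_eq_one p fun _ h => h, one_mul]
        exact h.sq_condProb_le hp fun _ h => h.2.symm.trans h.1
    | query e he hO hC _ _ ih1 ih0 =>
      obtain ⟨x1, y1, g1, hx1, hy1⟩ := ih1
      obtain ⟨x0, y0, g0, hx0, hy0⟩ := ih0
      refine ⟨p e * x1 + (1 - p e) * x0, p e * y1 + (1 - p e) * y0, ?_,
        sq_le_of_query hp (Conn.monotone _ _) (Conn.monotone _ _) he hO hC hx1 hx0,
        sq_le_of_query hp (Conn.monotone _ _) (Conn.monotone _ _) he hO hC hy1 hy0⟩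
      rw [condProb_split G he hC]
      linarith [mul_le_mul_of_nonneg_left g1 (hp e).1,
        mul_le_mul_of_nonneg_left g0 (sub_nonneg.2 (hp e).2)]
  obtain ⟨x, y, hg, hx, hy⟩ := main (explorable_empty F hab hac hbc)
  rw [condProb_empty] at hg
  rw [condProb_empty, splitProb_empty] at hx hy
  have hcb : finProb F p (fun T => Conn ι T c b) = finProb F p (fun T => Conn ι T b c) := by
    congr 1
    exact funext fun T => propext ⟨Conn.symm, Conn.symm⟩
  rw [hcb] at hy
  -- `(x + y) ^ 2 ≤ 2 * (x ^ 2 + y ^ 2)`, and each square is at most twice the product: `2 * (2 + 2)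
  -- = 8`.
  nlinarith [pow_le_pow_left₀ (finProb_nonneg hp _) hg 2, sq_nonneg (x - y)]

end Exploration

/-! ### From finite edge sets to the percolation measure. -/

section Measure

open MeasureTheory ProbabilityTheory Filter Topology

variable {V : Type*} {G : SimpleGraph V}

instance percMeasure.isProbabilityMeasure (p : G.edgeSet → unitInterval) :
    IsProbabilityMeasure (percMeasure G p) := by
  unfold percMeasure; infer_instance

/-- The open edges of `ω` in the finite set `F`. -/
def openIn (F : Finset G.edgeSet) (ω : Config G) : Finset G.edgeSet :=
  F.filter fun e => ω e = true

lemma openIn_mono {F F' : Finset G.edgeSet} (h : F ⊆ F') (ω : Config G) :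
    openIn F ω ⊆ openIn F' ω := Finset.filter_subset_filter _ h

lemma setOf_openIn_eq [DecidableEq G.edgeSet] {F T : Finset G.edgeSet} (hT : T ⊆ F) :
    {ω : Config G | openIn F ω = T} =
      Set.pi (F : Set G.edgeSet) fun e => {decide (e ∈ T)} := by
  ext ω
  simp only [openIn, Finset.ext_iff, Finset.mem_filter, Set.mem_ofPred_eq, Set.mem_pi,
    Finset.mem_coe, Set.mem_singleton_iff]
  refine ⟨fun h e he => ?_, fun h e => ⟨fun ⟨he, ho⟩ => ?_, fun he => ⟨hT he, ?_⟩⟩⟩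
  · have := h e
    by_cases heT : e ∈ T <;> simp_all
  · simpa [ho] using h e he
  · simpa [he] using h e (hT he)

lemma prob_openIn_eq [DecidableEq G.edgeSet] (p : G.edgeSet → unitInterval)
    {F T : Finset G.edgeSet} (hT : T ⊆ F) :
    prob G p {ω | openIn F ω = T} = weight F (fun e => (p e : ℝ)) T := by
  rw [setOf_openIn_eq hT, prob, percMeasure, measureReal_def,
    Measure.infinitePi_pi _ fun e _ => measurableSet_singleton _, ENNReal.toReal_prod, weight,
    ← Finset.prod_sdiff hT, mul_comm]
  congr 1
  · refine Finset.prod_congr rfl fun e he => ?_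
    rw [← measureReal_def, bernoulliMeasure_real_apply _ (measurableSet_singleton _)]
    simp [he]
  · refine Finset.prod_congr rfl fun e he => ?_
    rw [← measureReal_def, bernoulliMeasure_real_apply _ (measurableSet_singleton _)]
    simp [(Finset.mem_sdiff.1 he).2]

lemma prob_openIn [DecidableEq G.edgeSet] (p : G.edgeSet → unitInterval) (F : Finset G.edgeSet)
    (A : Finset G.edgeSet → Prop) :
    prob G p {ω | A (openIn F ω)} = finProb F (fun e => (p e : ℝ)) A := by
  classical
  have hU : {ω : Config G | A (openIn F ω)} =
      ⋃ T ∈ F.powerset.filter A, {ω | openIn F ω = T} := by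
    ext ω
    simp only [Set.mem_ofPred_eq, Finset.mem_filter, Finset.mem_powerset, Set.mem_iUnion,
      exists_prop, exists_eq_right']
    exact ⟨fun h => ⟨Finset.filter_subset _ _, h⟩, fun h => h.2⟩
  rw [hU, prob, measureReal_biUnion_finset, finProb, expect, Finset.sum_filter]
  · refine Finset.sum_congr rfl fun T hT => ?_
    by_cases hA : A T
    · rw [if_pos hA, ind_of_true hA, mul_one]
      exact prob_openIn_eq p (Finset.mem_powerset.1 hT)
    · rw [if_neg hA, ind_of_false hA, mul_zero]
  · intro S _ T _ hST
    exact Set.disjoint_left.2 fun ω h h' => hST (h.symm.trans h')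
  · intro T hT
    rw [setOf_openIn_eq (Finset.mem_powerset.1 (Finset.mem_filter.1 hT).1)]
    exact MeasurableSet.pi F.countable_toSet fun e _ => measurableSet_singleton _

/-- An open path uses finitely many edges, so connection is an increasing union of finite-volume
events. -/
lemma reachable_openGraph_iff (ω : Config G) (u v : V) :
    (openGraph G ω).Reachable u v ↔
      ∃ F : Finset G.edgeSet, Conn Subtype.val (openIn F ω) u v := by
  classical
  rw [SimpleGraph.reachable_iff_reflTransGen]
  constructor
  · intro h
    induction h with
    | refl => exact ⟨∅, Conn.refl _ _⟩
    | @tail v w _ hvw ih =>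
      obtain ⟨F, hF⟩ := ih
      obtain ⟨hadj, ho⟩ := hvw
      refine ⟨insert ⟨s(v, w), hadj⟩ F, (hF.mono (openIn_mono (Finset.subset_insert _ _) ω)).trans
        (Conn.single (e := ⟨s(v, w), hadj⟩) ?_ rfl)⟩
      simp [openIn, ho]
  · rintro ⟨F, hF⟩
    refine Relation.ReflTransGen.mono ?_ u v hF
    rintro x y ⟨⟨e, he⟩, heF, rfl⟩
    exact ⟨he, (Finset.mem_filter.1 heF).2⟩

/-- Probabilities of increasing events are limits of their finite-volume versions. -/
lemma tendsto_finProb [DecidableEq G.edgeSet] [Countable G.edgeSet]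
    (p : G.edgeSet → unitInterval) {A : Finset G.edgeSet → Prop} (hA : Monotone A)
    {s : Set (Config G)} (hs : ∀ ω, ω ∈ s ↔ ∃ F, A (openIn F ω)) :
    Tendsto (fun F => finProb F (fun e => (p e : ℝ)) A) atTop (𝓝 (prob G p s)) := by
  have hmono : Monotone fun F : Finset G.edgeSet => {ω : Config G | A (openIn F ω)} :=
    fun F F' h ω hω => hA (openIn_mono h ω) hω
  have hU : s = ⋃ F : Finset G.edgeSet, {ω : Config G | A (openIn F ω)} := by
    ext ω
    simp [hs]
  have := (ENNReal.tendsto_toReal (measure_ne_top _ _)).comp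
    (tendsto_measure_iUnion_atTop (μ := percMeasure G p) hmono)
  rw [← hU] at this
  simp only [← prob_openIn]
  exact this

lemma mem_sameCluster_pair (ω : Config G) (u v : V) :
    ω ∈ sameCluster G {u, v} ↔
      ∃ F : Finset G.edgeSet, Conn Subtype.val (openIn F ω) u v := by
  rw [← reachable_openGraph_iff]
  simp only [sameCluster, Set.mem_ofPred_eq, Set.mem_insert_iff, Set.mem_singleton_iff]
  refine ⟨fun h => h u (.inl rfl) v (.inr rfl), fun h => ?_⟩
  rintro x (rfl | rfl) y (rfl | rfl)
  exacts [.rfl, h, h.symm, .rfl]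

lemma mem_sameCluster_pair_union (ω : Config G) (u v w : V) :
    ω ∈ sameCluster G {u, v} ∪ sameCluster G {u, w} ↔
      ∃ F : Finset G.edgeSet, Conn Subtype.val (openIn F ω) u v ∨
        Conn Subtype.val (openIn F ω) u w := by
  rw [Set.mem_union, mem_sameCluster_pair, mem_sameCluster_pair, exists_or]

lemma mem_sameCluster_triple (ω : Config G) (u v w : V) :
    ω ∈ sameCluster G {u, v, w} ↔
      ∃ F : Finset G.edgeSet, Conn Subtype.val (openIn F ω) u v ∧
        Conn Subtype.val (openIn F ω) u w := by
  classical
  have : ω ∈ sameCluster G {u, v, w} ↔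
      (openGraph G ω).Reachable u v ∧ (openGraph G ω).Reachable u w := by
    simp only [sameCluster, Set.mem_ofPred_eq, Set.mem_insert_iff, Set.mem_singleton_iff]
    refine ⟨fun h => ⟨h u (.inl rfl) v (.inr (.inl rfl)), h u (.inl rfl) w (.inr (.inr rfl))⟩,
      fun ⟨hv, hw⟩ => ?_⟩
    rintro x (rfl | rfl | rfl) y (rfl | rfl | rfl)
    exacts [.rfl, hv, hw, hv.symm, .rfl, hv.symm.trans hw, hw.symm, hw.symm.trans hv, .rfl]
  rw [this, reachable_openGraph_iff, reachable_openGraph_iff]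
  -- The two connections may need different finite sets; their union serves both.
  refine ⟨fun ⟨⟨F, hF⟩, F', hF'⟩ => ⟨F ∪ F', ?_, ?_⟩, fun ⟨F, h, h'⟩ => ⟨⟨F, h⟩, F, h'⟩⟩
  · exact hF.mono (openIn_mono Finset.subset_union_left ω)
  · exact hF'.mono (openIn_mono Finset.subset_union_right ω)

/-- Needed for continuity of the measure along the finite edge sets. By induction on `n`, only
countably many vertices have a walk of length `n` to a fixed vertex. -/
lemma countable_of_connected_of_locallyFinite [G.LocallyFinite] (hG : G.Connected) :
    Countable V := by
  obtain ⟨a⟩ := hG.nonempty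
  have hc : ∀ n : ℕ, {v | ∃ q : G.Walk v a, q.length = n}.Countable := by
    intro n
    induction n with
    | zero =>
      refine (Set.countable_singleton a).mono ?_
      rintro v ⟨q, hq⟩
      exact SimpleGraph.Walk.eq_of_length_eq_zero hq
    | succ n ih =>
      refine (ih.biUnion fun v _ => (G.neighborSet v).toFinite.countable).mono ?_
      rintro v ⟨q, hq⟩
      cases q with
      | nil => simp at hq
      | @cons _ w _ h q =>
        exact Set.mem_biUnion (show w ∈ {v | ∃ q : G.Walk v a, q.length = n} from
          ⟨q, by simpa using hq⟩) h.symm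
  rw [← Set.countable_univ_iff]
  refine (Set.countable_iUnion hc).mono fun v _ => ?_
  obtain ⟨q⟩ := hG.preconnected v a
  exact Set.mem_iUnion.2 ⟨q.length, q, rfl⟩

end Measure

end BondPercolation

theorem mainTheorem1 {V : Type*} (G : SimpleGraph V) [G.LocallyFinite] (hG : G.Connected)
    (p : G.edgeSet → unitInterval) (a b c : V) (hab : a ≠ b) (hac : a ≠ c) (hbc : b ≠ c) :
    prob G p (sameCluster G {a, b, c}) ^ 2 ≤
        8 * prob G p (sameCluster G {a, b}) * prob G p (sameCluster G {a, c}) *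
          prob G p (sameCluster G {b, c}) ∧
    prob G p (sameCluster G {a, b, c}) ^ 2 ≤
        2 * prob G p (sameCluster G {a, b} ∪ sameCluster G {a, c}) ^ 2 *
          prob G p (sameCluster G {b, c}) ∧
    (0 < prob G p (sameCluster G {a, b}) * prob G p (sameCluster G {a, c}) *
          prob G p (sameCluster G {b, c}) →
      prob G p (sameCluster G {a, b, c}) /
          √(prob G p (sameCluster G {a, b}) * prob G p (sameCluster G {a, c}) *
            prob G p (sameCluster G {b, c})) ≤ √8) := by
  classical
  have : Countable V := countable_of_connected_of_locallyFinite hG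
  have hp : ∀ e, (p e : ℝ) ∈ Set.Icc (0 : ℝ) 1 := fun e => (p e).2
  have h2 := fun u v => tendsto_finProb p (Conn.monotone (ι := Subtype.val) u v)
    (mem_sameCluster_pair · u v)
  have h3 := tendsto_finProb p
    (A := fun T => Conn Subtype.val T a b ∧ Conn Subtype.val T a c)
    (fun _ _ h => And.imp (.mono h) (.mono h)) (mem_sameCluster_triple · a b c)
  have hor := tendsto_finProb p
    (A := fun T => Conn Subtype.val T a b ∨ Conn Subtype.val T a c)
    (fun _ _ h => Or.imp (.mono h) (.mono h)) (mem_sameCluster_pair_union · a b c)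
  have main : prob G p (sameCluster G {a, b, c}) ^ 2 ≤
      8 * prob G p (sameCluster G {a, b}) * prob G p (sameCluster G {a, c}) *
        prob G p (sameCluster G {b, c}) :=
    le_of_tendsto_of_tendsto' (h3.pow 2) ((((h2 a b).const_mul 8).mul (h2 a c)).mul (h2 b c))
      fun F => sq_finProb_le_eight_mul F hp hab hac hbc
  refine ⟨main, ?_, fun hpos => ?_⟩
  · exact le_of_tendsto_of_tendsto' (h3.pow 2) (((hor.pow 2).const_mul 2).mul (h2 b c))
      fun F => sq_finProb_le_two_mul F hp hab hac hbc
  · rw [div_le_iff₀ (Real.sqrt_pos.2 hpos), ← Real.sqrt_mul (by norm_num)]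
    exact Real.le_sqrt_of_sq_le (main.trans_eq (by ring))
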